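/- Let $\mathbb{C}_+$ be the open upper half-plane and let $H^\infty_1$ be the set of holomorphic functions $b$ on $\mathbb{C}_+$ with $\sup_{\mathbb{C}_+}|b|\le 1$. For $b\in H^\infty_1$ let $\mathcal{H}(b)$ be the de Branges--Rovnyak space, i.e. the reproducing kernel Hilbert space of functions on $\mathbb{C}_+$ with kernel $$k_\lambda^b(z)=\frac{i}{2\pi}\,\frac{1-\overline{b(\lambda)}\,b(z)}{z-\overline{\lambda}},\qquad \lambda,z\in\mathbb{C}_+,$$ and let $\kappa_\lambda^b=k_\lambda^b/\|k_\lambda^b\|_b$ be the normalized kernels. A sequence $(x_n)_{n\ge p}$ in a Hilbert space is an asymptotically orthonormal basic sequence (AOB) if for every $N\ge p$ there are constants $c_N,C_N>0$ with $$c_N\sum_{n\ge N}|a_n|^2\le\Big\|\sum_{n\ge N}a_nx_n\Big\|^2\le C_N\sum_{n\ge N}|a_n|^2$$ for all finitely supported complex sequences $(a_n)$, and $c_N\to1$, $C_N\to 1$ as $N\to\infty$; it is complete if its closed linear span is the whole space. Let $b_1=b_2b$ with $b_2,b\in H^\infty_1$, where $b_2$ is not a constant of modulus one, and let $(\lambda_n)_{n\ge1}\subset\mathbb{C}_+$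 satisfy $$\sum_{n\ge1}\left|\frac{\|k_{\lambda_n}^{b_1}\|_{b_1}^2}{\|k_{\lambda_n}^{b_2}\|_{b_2}^2}-1\right|=\sum_{n\ge1}\left|\frac{1-|b_1(\lambda_n)|^2}{1-|b_2(\lambda_n)|^2}-1\right|<\infty.$$ (1) If $(\kappa_{\lambda_n}^{b_1})_{n\ge1}$ is a complete AOB in $\mathcal{H}(b_1)$, then there is an integer $p\ge1$ such that $(\kappa_{\lambda_n}^{b_2})_{n\ge p}$ is a complete AOB in $\mathcal{H}(b_2)$. (2) Conversely, if $(\kappa_{\lambda_n}^{b_2})_{n\ge1}$ is an AOB in $\mathcal{H}(b_2)$, then $(\kappa_{\lambda_n}^{b_1})_{n\ge1}$ is an AOB in $\mathcal{H}(b_1)$. -/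

import Mathlib

open scoped ComplexConjugate

namespace HbSpace

open Metric Complex
open scoped UpperHalfPlane Manifold

lemma diff_cauchy {ι : Type*} (s : Finset ι) (w c : ι → ℂ) (hw : ∀ j, ‖w j‖ < 1) {z : ℂ}
    (hz : z ∈ closedBall (0 : ℂ) 1) :
    DifferentiableAt ℂ (fun z => ∑ j ∈ s, c j / (1 - conj (w j) * z)) z := by
  have h (j : ι) : 1 - conj (w j) * z ≠ 0 := by
    intro h0
    have h1 : conj (w j) * z = 1 := (sub_eq_zero.mp h0).symm
    have h2 : ‖w j‖ * ‖z‖ = 1 := by simpa using congrArg norm h1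
    have h3 : ‖z‖ ≤ 1 := by simpa using hz
    nlinarith [hw j, norm_nonneg (w j), norm_nonneg z]
  refine DifferentiableAt.fun_sum fun j _ => ?_
  exact (differentiableAt_const _).div (by fun_prop) (h j)

lemma circleIntegrable_of_cont {f : ℂ → ℂ} (hf : ∀ z ∈ closedBall (0 : ℂ) 1, ContinuousAt f z) :
    CircleIntegrable f 0 1 :=
  ContinuousOn.circleIntegrable zero_le_one
    fun z hz => (hf z (sphere_subset_closedBall hz)).continuousWithinAt

lemma circleAverage_cauchy {ι : Type*} (s : Finset ι) (w c : ι → ℂ) (hw : ∀ j, ‖w j‖ < 1)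
    {h : ℂ → ℂ} (hh : ∀ z ∈ closedBall (0 : ℂ) 1, DifferentiableAt ℂ h z) :
    Real.circleAverage (fun z => h z * conj (∑ j ∈ s, c j / (1 - conj (w j) * z))) 0 1
      = ∑ j ∈ s, conj (c j) * h (w j) := by
  have hne (j : ι) : ∀ z ∈ sphere (0 : ℂ) 1, z - w j ≠ 0 := by
    intro z hz h0
    have h1 : ‖z‖ = 1 := by simpa using hz
    rw [sub_eq_zero.mp h0] at h1
    linarith [hw j]
  have e1 : Set.EqOn (fun z => h z * conj (∑ j ∈ s, c j / (1 - conj (w j) * z)))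
      (fun z => ∑ j ∈ s, conj (c j) • (((z - 0) / (z - w j)) • h z)) (sphere (0 : ℂ) |1|) := by
    intro z hz
    rw [abs_one] at hz
    have h1 : ‖z‖ = 1 := by simpa using hz
    have hz0 : z ≠ 0 := by rintro rfl; simp at h1
    have hc : conj z = z⁻¹ := by
      rw [Complex.inv_def, Complex.normSq_eq_norm_sq, h1]; simp
    simp only [map_sum, Finset.mul_sum, smul_eq_mul, sub_zero]
    refine Finset.sum_congr rfl fun j _ => ?_
    have := hne j z hz
    simp only [map_div₀, map_sub, map_one, map_mul, Complex.conj_conj, hc]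
    have h2 : 1 - w j * z⁻¹ = (z - w j) / z := by field_simp
    rw [h2]
    field_simp
  rw [Real.circleAverage_congr_sphere e1, Real.circleAverage_fun_sum]
  · refine Finset.sum_congr rfl fun j _ => ?_
    rw [Real.circleAverage_fun_smul, DiffContOnCl.circleAverage_smul_div]
    · rfl
    · refine DifferentiableOn.diffContOnCl fun z hz => ?_
      rw [abs_one, closure_ball _ one_ne_zero] at hz
      exact (hh z hz).differentiableWithinAt
    · simpa using hw j
  · intro j _
    refine ContinuousOn.circleIntegrable zero_le_one fun z hz => ContinuousAt.continuousWithinAt ?_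
    have h1 := (hh z (sphere_subset_closedBall hz)).continuousAt
    have h2 := hne j z hz
    have h3 : ContinuousAt (fun z => (z - 0) / (z - w j)) z :=
      ContinuousAt.div (by fun_prop) (by fun_prop) h2
    exact (h3.smul h1).const_smul (conj (c j))

lemma disc_nonneg_aux {ι : Type*} (s : Finset ι) (w c : ι → ℂ) (hw : ∀ j, ‖w j‖ < 1) {g : ℂ → ℂ}
    (hg : ∀ z ∈ closedBall (0 : ℂ) 1, DifferentiableAt ℂ g z)
    (hb : ∀ z ∈ closedBall (0 : ℂ) 1, ‖g z‖ ≤ 1) :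
    0 ≤ (∑ k ∈ s, ∑ j ∈ s, conj (c k) * c j *
      ((1 - conj (g (w j)) * g (w k)) / (1 - conj (w j) * w k))).re := by
  set F : ℂ → ℂ := fun z => ∑ j ∈ s, c j / (1 - conj (w j) * z) with hF
  set G : ℂ → ℂ := fun z => ∑ j ∈ s, (c j * conj (g (w j))) / (1 - conj (w j) * z) with hG
  have dF : ∀ z ∈ closedBall (0 : ℂ) 1, DifferentiableAt ℂ F z := fun z hz => diff_cauchy s w c hw hz
  have dG : ∀ z ∈ closedBall (0 : ℂ) 1, DifferentiableAt ℂ G z := fun z hz =>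
    diff_cauchy s w _ hw hz
  have a1 : Real.circleAverage (fun z => F z * conj (F z)) 0 1 = ∑ k ∈ s, conj (c k) * F (w k) :=
    circleAverage_cauchy s w c hw dF
  have a2 : Real.circleAverage (fun z => G z * conj (G z)) 0 1
      = ∑ k ∈ s, conj (c k * conj (g (w k))) * G (w k) :=
    circleAverage_cauchy s w _ hw dG
  have a3 : Real.circleAverage (fun z => (g z * G z) * conj (F z)) 0 1
      = ∑ k ∈ s, conj (c k) * (g (w k) * G (w k)) :=
    circleAverage_cauchy s w c hw (h := fun z => g z * G z) fun z hz => (hg z hz).mul (dG z hz)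
  have i1 : CircleIntegrable (fun z => F z * conj (F z)) 0 1 := circleIntegrable_of_cont
    fun z hz => (dF z hz).continuousAt.mul
      (Complex.continuous_conj.continuousAt.comp (dF z hz).continuousAt)
  have i2 : CircleIntegrable (fun z => G z * conj (G z)) 0 1 := circleIntegrable_of_cont
    fun z hz => (dG z hz).continuousAt.mul
      (Complex.continuous_conj.continuousAt.comp (dG z hz).continuousAt)
  have i3 : CircleIntegrable (fun z => (g z * G z) * conj (F z)) 0 1 := circleIntegrable_of_cont
    fun z hz => ((hg z hz).continuousAt.mul (dG z hz).continuousAt).mul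
      (Complex.continuous_conj.continuousAt.comp (dF z hz).continuousAt)
  have e : (∑ k ∈ s, ∑ j ∈ s, conj (c k) * c j *
      ((1 - conj (g (w j)) * g (w k)) / (1 - conj (w j) * w k)))
      = Real.circleAverage (fun z => (F z * conj (F z) + G z * conj (G z))
        - ((g z * G z) * conj (F z) + (g z * G z) * conj (F z))) 0 1 := by
    refine Eq.trans ?_ (Real.circleAverage_sub (i1.add i2) (i3.add i3)).symm
    rw [Real.circleAverage_add i1 i2, Real.circleAverage_add i3 i3, a1, a2, a3]
    simp only [hF, hG, Finset.mul_sum, ← Finset.sum_add_distrib, ← Finset.sum_sub_distrib]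
    refine Finset.sum_congr rfl fun k _ => Finset.sum_congr rfl fun j _ => ?_
    simp only [map_mul, Complex.conj_conj]
    ring
  rw [e]
  have hI := (i1.add i2).sub (i3.add i3)
  have := Complex.reCLM.circleAverage_comp_comm hI
  have h4 : (Real.circleAverage (fun z => (F z * conj (F z) + G z * conj (G z))
        - ((g z * G z) * conj (F z) + (g z * G z) * conj (F z))) 0 1).re
      = Real.circleAverage (fun z => ((F z * conj (F z) + G z * conj (G z))
        - ((g z * G z) * conj (F z) + (g z * G z) * conj (F z))).re) 0 1 := this.symm
  rw [h4]
  refine Real.circleAverage_nonneg_of_nonneg fun z hz => ?_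
  rw [abs_one] at hz
  have hgz := hb z (sphere_subset_closedBall hz)
  have h5 : (g z * G z * conj (F z)).re ≤ ‖G z‖ * ‖F z‖ := by
    refine (Complex.re_le_norm _).trans ?_
    simp only [norm_mul, RCLike.norm_conj]
    nlinarith [norm_nonneg (G z), norm_nonneg (F z), mul_nonneg (norm_nonneg (G z)) (norm_nonneg (F z))]
  have h6 (u : ℂ) : (u * conj u).re = ‖u‖ ^ 2 := by
    rw [Complex.mul_conj, Complex.ofReal_re, Complex.normSq_eq_norm_sq]
  simp only [Complex.sub_re, Complex.add_re, h6]
  nlinarith [sq_nonneg (‖F z‖ - ‖G z‖)]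

lemma disc_nonneg {ι : Type*} (s : Finset ι) (w c : ι → ℂ) (hw : ∀ j, ‖w j‖ < 1) {g : ℂ → ℂ}
    (hg : DifferentiableOn ℂ g (ball (0 : ℂ) 1)) (hb : ∀ z ∈ ball (0 : ℂ) 1, ‖g z‖ ≤ 1) :
    0 ≤ (∑ k ∈ s, ∑ j ∈ s, conj (c k) * c j *
      ((1 - conj (g (w j)) * g (w k)) / (1 - conj (w j) * w k))).re := by
  have hg' : ∀ z ∈ ball (0 : ℂ) 1, DifferentiableAt ℂ g z := fun z hz =>
    (hg z hz).differentiableAt (isOpen_ball.mem_nhds hz)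
  have hcont (j : ι) : Filter.Tendsto (fun r : ℝ => g (r * w j)) (nhdsWithin 1 (Set.Iio 1))
      (nhds (g (w j))) := by
    have h1 : ContinuousAt g (((1 : ℝ) : ℂ) * w j) := by
      simpa using (hg' (w j) (by simpa using hw j)).continuousAt
    have h2 : ContinuousAt (fun r : ℝ => (r : ℂ) * w j) 1 := by fun_prop
    have h3 : ContinuousAt (fun r : ℝ => g (r * w j)) 1 :=
      ContinuousAt.comp (f := fun r : ℝ => (r : ℂ) * w j) h1 h2
    have h4 := h3.tendsto
    simp only [Complex.ofReal_one, one_mul] at h4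
    exact h4.mono_left nhdsWithin_le_nhds
  have hlim : Filter.Tendsto (fun r : ℝ => (∑ k ∈ s, ∑ j ∈ s, conj (c k) * c j *
      ((1 - conj (g (r * w j)) * g (r * w k)) / (1 - conj (w j) * w k))).re)
      (nhdsWithin 1 (Set.Iio 1)) (nhds (∑ k ∈ s, ∑ j ∈ s, conj (c k) * c j *
      ((1 - conj (g (w j)) * g (w k)) / (1 - conj (w j) * w k))).re) := by
    refine (Complex.continuous_re.tendsto _).comp ?_
    refine tendsto_finsetSum _ fun k _ => tendsto_finsetSum _ fun j _ => ?_
    refine Filter.Tendsto.const_mul _ (Filter.Tendsto.div_const ?_ _)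
    exact tendsto_const_nhds.sub
      (((Complex.continuous_conj.tendsto _).comp (hcont j)).mul (hcont k))
  refine ge_of_tendsto hlim ?_
  filter_upwards [Ioo_mem_nhdsLT (show (0 : ℝ) < 1 by norm_num)] with r hr
  have hmem : ∀ z ∈ closedBall (0 : ℂ) 1, (r : ℂ) * z ∈ ball (0 : ℂ) 1 := by
    intro z hz
    have : ‖z‖ ≤ 1 := by simpa using hz
    simp only [mem_ball, dist_zero_right, norm_mul, Complex.norm_real, Real.norm_eq_abs,
      abs_of_pos hr.1]
    nlinarith [hr.1, hr.2]
  exact disc_nonneg_aux s w c hw (g := fun z => g (r * z))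
    (fun z hz => (hg' _ (hmem z hz)).comp z (by fun_prop)) (fun z hz => hb _ (hmem z hz))

/-- The closed unit ball of `H^∞` of the upper half-plane: holomorphic functions on `ℍ` that are
bounded by `1` in modulus. -/
structure HInfBall where
  toFun : ℍ → ℂ
  holo : MDifferentiable 𝓘(ℂ) 𝓘(ℂ) toFun
  bound : ∀ z, ‖toFun z‖ ≤ 1

instance : CoeFun HInfBall fun _ => ℍ → ℂ := ⟨HInfBall.toFun⟩

/-- `k_λ^b(z) = (i / 2π) (1 - conj (b λ) b z) / (z - conj λ)`. -/
noncomputable def kernelValue (b : HInfBall) (l z : ℍ) : ℂ :=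
  I / (2 * Real.pi) * ((1 - conj (b l) * b z) / ((z : ℂ) - conj (l : ℂ)))

/-- The kernel of `𝓗(b)`, in the operator-valued form that Mathlib's reproducing kernel Hilbert
spaces use: the entry at `(z, λ)` is multiplication by `k_λ^b(z)`. -/
noncomputable def kernelMatrix (b : HInfBall) : Matrix ℍ ℍ (ℂ →L[ℂ] ℂ) :=
  Matrix.of fun z l => kernelValue b l z • ContinuousLinearMap.id ℂ ℂ

lemma sub_conj_ne_zero (z l : ℍ) : (z : ℂ) - conj (l : ℂ) ≠ 0 := by
  intro h
  have h1 := congrArg Complex.im h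
  simp only [Complex.sub_im, Complex.conj_im, Complex.zero_im, UpperHalfPlane.coe_im] at h1
  linarith [z.im_pos, l.im_pos]

lemma add_I_ne_zero (z : ℍ) : (z : ℂ) + I ≠ 0 := by
  intro h
  have h1 := congrArg Complex.im h
  simp only [Complex.add_im, Complex.I_im, Complex.zero_im, UpperHalfPlane.coe_im] at h1
  linarith [z.im_pos]

lemma conj_kernelValue (b : HInfBall) (l z : ℍ) : conj (kernelValue b l z) = kernelValue b z l := by
  have h1 := sub_conj_ne_zero z l
  have h2 := sub_conj_ne_zero l z
  have h3 : conj (z : ℂ) - l ≠ 0 := by rw [← neg_sub]; exact neg_ne_zero.mpr h2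
  simp only [kernelValue, map_mul, map_div₀, map_sub, map_one, Complex.conj_conj, Complex.conj_I,
    Complex.conj_ofReal, map_ofNat]
  have hpi : (Real.pi : ℂ) ≠ 0 := by exact_mod_cast Real.pi_ne_zero
  field_simp
  ring

lemma norm_cayley_lt (z : ℍ) : ‖((z : ℂ) - I) / (z + I)‖ < 1 := by
  rw [norm_div, div_lt_one (norm_pos_iff.mpr (add_I_ne_zero z))]
  refine lt_of_pow_lt_pow_left₀ 2 (norm_nonneg _) ?_
  rw [← Complex.normSq_eq_norm_sq, ← Complex.normSq_eq_norm_sq, Complex.normSq_apply,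
    Complex.normSq_apply]
  simp only [Complex.sub_re, Complex.sub_im, Complex.add_re, Complex.add_im, Complex.I_re,
    Complex.I_im, UpperHalfPlane.coe_im, UpperHalfPlane.coe_re]
  nlinarith [z.im_pos]

lemma kernelValue_cayley (b : HInfBall) (l z : ℍ) :
    kernelValue b l z = (1 / Real.pi : ℝ) * ((conj ((l : ℂ) + I))⁻¹ * ((z : ℂ) + I)⁻¹ *
      ((1 - conj (b l) * b z) /
        (1 - conj (((l : ℂ) - I) / (l + I)) * (((z : ℂ) - I) / (z + I))))) := by
  have h1 := sub_conj_ne_zero z l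
  have h2 := add_I_ne_zero z
  have h3 : conj (l : ℂ) - I ≠ 0 := by
    have := (map_ne_zero (starRingEnd ℂ)).mpr (add_I_ne_zero l)
    simpa [sub_eq_add_neg] using this
  have hpi : (Real.pi : ℂ) ≠ 0 := by exact_mod_cast Real.pi_ne_zero
  have e : 1 - conj (((l : ℂ) - I) / (l + I)) * (((z : ℂ) - I) / (z + I))
      = -(2 * I) * ((z : ℂ) - conj (l : ℂ)) / ((conj (l : ℂ) - I) * ((z : ℂ) + I)) := by
    simp only [map_div₀, map_sub, map_add, Complex.conj_I]
    rw [← sub_eq_add_neg]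
    field_simp
    ring
  rw [e]
  simp only [kernelValue, map_add, Complex.conj_I, ← sub_eq_add_neg]
  push_cast
  field_simp
  rw [Complex.I_sq]
  ring

lemma holo_cayley (b : HInfBall) : DifferentiableOn ℂ
    (fun w : ℂ => b (UpperHalfPlane.ofComplex (I * (1 + w) / (1 - w)))) (ball (0 : ℂ) 1) := by
  have hb := UpperHalfPlane.mdifferentiable_iff.mp b.holo
  have hne : ∀ w ∈ ball (0 : ℂ) 1, 1 - w ≠ 0 := by
    intro w hw h
    rw [← sub_eq_zero.mp h] at hw
    simp at hw
  refine DifferentiableOn.comp (t := {z : ℂ | 0 < z.im}) hb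
    (f := fun w : ℂ => I * (1 + w) / (1 - w)) ?_ ?_
  · exact DifferentiableOn.div (by fun_prop) (by fun_prop) hne
  · intro w hw
    have h1 := hne w hw
    have h2 : ‖w‖ ^ 2 < 1 := by
      have : ‖w‖ < 1 := by simpa using hw
      nlinarith [norm_nonneg w]
    rw [← Complex.normSq_eq_norm_sq, Complex.normSq_apply] at h2
    have h3 : 0 < Complex.normSq (1 - w) := Complex.normSq_pos.mpr h1
    have h4 : (I * (1 + w) / (1 - w)).im
        = (1 - (w.re * w.re + w.im * w.im)) / Complex.normSq (1 - w) := by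
      rw [Complex.div_im]
      simp only [Complex.mul_im, Complex.mul_re, Complex.I_re, Complex.I_im, Complex.add_re,
        Complex.add_im, Complex.sub_re, Complex.sub_im, Complex.one_re, Complex.one_im]
      field_simp
      ring
    change 0 < (I * (1 + w) / (1 - w)).im
    rw [h4]
    exact div_pos (by linarith) h3

lemma cayley_inv (z : ℍ) : UpperHalfPlane.ofComplex
    (I * (1 + ((z : ℂ) - I) / (z + I)) / (1 - ((z : ℂ) - I) / (z + I))) = z := by
  have h2 := add_I_ne_zero z
  have : I * (1 + ((z : ℂ) - I) / (z + I)) / (1 - ((z : ℂ) - I) / (z + I)) = z := by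
    have e1 : 1 + ((z : ℂ) - I) / (z + I) = 2 * z / (z + I) := by field_simp; ring
    have e2 : 1 - ((z : ℂ) - I) / (z + I) = 2 * I / (z + I) := by field_simp; ring
    rw [e1, e2]
    field_simp
  rw [this, UpperHalfPlane.ofComplex_apply]

lemma kernelValue_nonneg (b : HInfBall) (s : Finset ℍ) (a : ℍ → ℂ) :
    0 ≤ (∑ z ∈ s, ∑ l ∈ s, conj (a z) * a l * kernelValue b l z).re := by
  have h := disc_nonneg s (fun z : ℍ => ((z : ℂ) - I) / (z + I))
    (fun z : ℍ => a z * (conj ((z : ℂ) + I))⁻¹) norm_cayley_lt (holo_cayley b)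
    (fun w _ => b.bound _)
  simp only [cayley_inv] at h
  have e : (∑ z ∈ s, ∑ l ∈ s, conj (a z) * a l * kernelValue b l z)
      = (1 / Real.pi : ℝ) * ∑ z ∈ s, ∑ l ∈ s, conj (a z * (conj ((z : ℂ) + I))⁻¹) *
        (a l * (conj ((l : ℂ) + I))⁻¹) * ((1 - conj (b l) * b z) /
        (1 - conj (((l : ℂ) - I) / (l + I)) * (((z : ℂ) - I) / (z + I)))) := by
    simp only [Finset.mul_sum]
    refine Finset.sum_congr rfl fun z _ => Finset.sum_congr rfl fun l _ => ?_
    rw [kernelValue_cayley, map_mul, map_inv₀, Complex.conj_conj]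
    ring
  rw [e, Complex.re_ofReal_mul]
  exact mul_nonneg (by positivity) h

lemma kernelMatrix_posSemidef (b : HInfBall) : (kernelMatrix b).PosSemidef := by
  have key := (RKHS.posSemidef_tfae (K := kernelMatrix b)).out 0 2
  refine key.mpr ⟨?_, fun v => ?_⟩
  · ext z l
    simp [Matrix.conjTranspose_apply, kernelMatrix, ← conj_kernelValue b l z,
      ContinuousLinearMap.star_eq_adjoint, ContinuousLinearMap.adjoint_id]
  · have h := kernelValue_nonneg b v.support fun z => v z
    have e : (v.sum fun x w => v.sum fun x' w' => inner ℂ (kernelMatrix b x' x w) w')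
        = conj (∑ z ∈ v.support, ∑ l ∈ v.support, conj (v z) * v l * kernelValue b l z) := by
      simp only [Finsupp.sum, map_sum]
      rw [Finset.sum_comm]
      refine Finset.sum_congr rfl fun z _ => Finset.sum_congr rfl fun l _ => ?_
      simp [kernelMatrix, RCLike.inner_apply]
      ring
    rw [e]
    change 0 ≤ (conj _ : ℂ).re
    rwa [Complex.conj_re]

instance (b : HInfBall) : Fact (kernelMatrix b).PosSemidef := ⟨kernelMatrix_posSemidef b⟩

/-- The de Branges--Rovnyak space `𝓗(b)`: the reproducing kernel Hilbert space of functions on `ℍ`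
with kernel `k_λ^b(z)`. -/
abbrev DBR (b : HInfBall) : Type := RKHS.OfKernel (kernelMatrix b)

/-- The reproducing kernel `k_λ^b` as an element of `𝓗(b)`. -/
noncomputable def repKernel (b : HInfBall) (l : ℍ) : DBR b := RKHS.kerFun (DBR b) l 1

lemma repKernel_apply (b : HInfBall) (l z : ℍ) : repKernel b l z = kernelValue b l z := by
  rw [repKernel, RKHS.kerFun_apply, RKHS.OfKernel.kernel_ofKernel]
  simp [kernelMatrix]

lemma inner_repKernel (b : HInfBall) (l : ℍ) (f : DBR b) : inner ℂ (repKernel b l) f = f l := by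
  simp [repKernel]

/-- The normalized reproducing kernel `κ_λ^b = k_λ^b / ‖k_λ^b‖_b`. -/
noncomputable def normKernel (b : HInfBall) (l : ℍ) : DBR b :=
  ((‖repKernel b l‖⁻¹ : ℝ) : ℂ) • repKernel b l

/-- `‖k_λ^{b₁}‖² / ‖k_λ^{b₂}‖²`. -/
noncomputable def kernelRatio (b₁ b₂ : HInfBall) (l : ℍ) : ℝ :=
  ‖repKernel b₁ l‖ ^ 2 / ‖repKernel b₂ l‖ ^ 2

lemma norm_repKernel_sq (b : HInfBall) (l : ℍ) :
    ‖repKernel b l‖ ^ 2 = (1 - ‖b l‖ ^ 2) / (4 * Real.pi * l.im) := by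
  have h : ((‖repKernel b l‖ ^ 2 : ℝ) : ℂ) = kernelValue b l l := by
    rw [← repKernel_apply, ← inner_repKernel, inner_self_eq_norm_sq_to_K]
    simp
  have hl : (l.im : ℂ) ≠ 0 := by exact_mod_cast l.im_pos.ne'
  have hpi : (Real.pi : ℂ) ≠ 0 := by exact_mod_cast Real.pi_ne_zero
  have h2 : kernelValue b l l = (((1 - ‖b l‖ ^ 2) / (4 * Real.pi * l.im) : ℝ) : ℂ) := by
    rw [kernelValue, Complex.conj_mul', Complex.sub_conj, UpperHalfPlane.coe_im]
    push_cast
    field_simp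
    ring
  exact_mod_cast h.trans h2

lemma kernelRatio_eq (b₁ b₂ : HInfBall) (l : ℍ) :
    kernelRatio b₁ b₂ l = (1 - ‖b₁ l‖ ^ 2) / (1 - ‖b₂ l‖ ^ 2) := by
  have h : 4 * Real.pi * l.im ≠ 0 := by have := l.im_pos; positivity
  rw [kernelRatio, norm_repKernel_sq, norm_repKernel_sq, div_div_div_cancel_right₀ h]

section AOB

variable {H : Type*} [NormedAddCommGroup H] [InnerProductSpace ℂ H]

/-- The defining property of an asymptotically orthonormal sequence with threshold `N₀`. Sequences
are indexed from `0`. -/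
def IsAOSFrom (N₀ : ℕ) (x : ℕ → H) : Prop :=
  ∃ c C : ℕ → ℝ,
    (∀ N, N₀ ≤ N → 0 < c N ∧ 0 < C N ∧ ∀ a : ℕ →₀ ℂ, (∀ n < N, a n = 0) →
      c N * (a.sum fun _ t => ‖t‖ ^ 2) ≤ ‖a.sum fun n t => t • x n‖ ^ 2 ∧
      ‖a.sum fun n t => t • x n‖ ^ 2 ≤ C N * (a.sum fun _ t => ‖t‖ ^ 2)) ∧
    Filter.Tendsto c Filter.atTop (nhds 1) ∧ Filter.Tendsto C Filter.atTop (nhds 1)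

/-- An asymptotically orthonormal basic sequence: the threshold is the first index. -/
def IsAOB (x : ℕ → H) : Prop := IsAOSFrom 0 x

/-- The closed linear span of the sequence is the whole space. -/
def IsCompleteSeq (x : ℕ → H) : Prop :=
  (Submodule.span ℂ (Set.range x)).topologicalClosure = ⊤

end AOB

end HbSpace

/-! The factorization gives `k_λ^{b₁}(z) = k_λ^{b₂}(z) + conj (b₂ λ) b₂(z) k_λ^b(z)`. Hence the Gram
matrix of `x_n = k_{λ_n}^{b₁} / ‖k_{λ_n}^{b₂}‖` is that of `y_n = κ_{λ_n}^{b₂}` plus that of defect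
vectors `e_n` with `‖e_n‖²` equal to the ratio of squared kernel norms minus `1`. By hypothesis
these are summable, so by Cauchy–Schwarz the defect part of `‖∑_{n ≥ N} a_n x_n‖²` is at most `τ_N ∑
|a_n|²` with `τ_N → 0`. Since `x_n` is `κ_{λ_n}^{b₁}` times a factor tending to `1`, asymptotic
orthonormality passes from `y` to `κ^{b₁}`, which is (2), and from `κ^{b₁}` to a tail of `y`
(`IsAOB.exists_isAOSFrom`).

Completeness in (1) is the delicate point. The inclusion `𝓗(b₂) ⊆ 𝓗(b₁)` makes the whole sequence
`(λ_n)` a uniqueness set for `𝓗(b₂)`, but passing to a tail could destroy this. Take `p` least such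
that `(y_n)_{n ≥ p}` has a positive lower Riesz bound. If `p = q + 1`, minimality forces every `f`
vanishing on the tail to vanish at `λ_q` too. Such `f` form a finite-dimensional space `V`, since
evaluation at the finitely many earlier points is injective on it, and division by the Blaschke
factor of `λ_q` maps `V` into itself. An eigenvector of this operator would be supported where the
Blaschke factor takes a single value, hence would be zero; so `V = 0`
(`eq_zero_of_forall_apply_eq_zero`). -/

namespace HbSpace

open scoped UpperHalfPlane

/-! ### Riesz bounds and perturbation of Gram matrices in abstract Hilbert spaces -/

section Hilbert

variable {H H' H'' : Type*} [NormedAddCommGroup H] [InnerProductSpace ℂ H]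
  [NormedAddCommGroup H'] [InnerProductSpace ℂ H'] [NormedAddCommGroup H'']
  [InnerProductSpace ℂ H'']

/-- A decomposition of Gram matrices gives a decomposition of the norms of linear combinations. -/
lemma norm_sq_sum_of_inner_eq_add {ι : Type*} {x : ι → H} {y : ι → H'} {e : ι → H''}
    (h : ∀ i j, inner ℂ (x i) (x j) = inner ℂ (y i) (y j) + inner ℂ (e i) (e j)) (a : ι →₀ ℂ) :
    ‖a.sum fun n t => t • x n‖ ^ 2
      = ‖a.sum fun n t => t • y n‖ ^ 2 + ‖a.sum fun n t => t • e n‖ ^ 2 := by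
  have key : inner ℂ (a.sum fun n t => t • x n) (a.sum fun n t => t • x n)
      = inner ℂ (a.sum fun n t => t • y n) (a.sum fun n t => t • y n)
        + inner ℂ (a.sum fun n t => t • e n) (a.sum fun n t => t • e n) := by
    simp only [Finsupp.sum, sum_inner, inner_sum, inner_smul_left, inner_smul_right, h,
      Finset.sum_add_distrib, mul_add]
  simp only [inner_self_eq_norm_sq_to_K] at key
  exact_mod_cast key

lemma norm_sum_le_of_inner_eq_add {ι : Type*} {x : ι → H} {y : ι → H'} {e : ι → H''}
    (h : ∀ i j, inner ℂ (x i) (x j) = inner ℂ (y i) (y j) + inner ℂ (e i) (e j)) (a : ι →₀ ℂ) :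
    ‖a.sum fun n t => t • y n‖ ≤ ‖a.sum fun n t => t • x n‖ := by
  refine (pow_le_pow_iff_left₀ (norm_nonneg _) (norm_nonneg _) two_ne_zero).mp ?_
  rw [norm_sq_sum_of_inner_eq_add h]
  exact le_add_of_nonneg_right (by positivity)

/-- A map between two families, one of them total, that does not increase the norms of linear
combinations extends to a bounded operator. -/
lemma exists_clm_of_norm_sum_le [CompleteSpace H'] {ι : Type*} {x : ι → H} {y : ι → H'}
    (hx : Dense (Submodule.span ℂ (Set.range x) : Set H))
    (h : ∀ a : ι →₀ ℂ, ‖a.sum fun n t => t • y n‖ ≤ ‖a.sum fun n t => t • x n‖) :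
    ∃ E : H →L[ℂ] H', ∀ i, E (x i) = y i := by
  have hd : DenseRange (Finsupp.linearCombination ℂ x) := by
    rw [DenseRange, ← LinearMap.coe_range, Finsupp.range_linearCombination]
    exact hx
  refine ⟨(Finsupp.linearCombination ℂ y).extendOfNorm (Finsupp.linearCombination ℂ x),
    fun i => ?_⟩
  have := LinearMap.extendOfNorm_eq (f := Finsupp.linearCombination ℂ y) hd
    ⟨1, fun a => by simpa [Finsupp.linearCombination_apply] using h a⟩ (Finsupp.single i 1)
  simpa using this

/-- Cauchy–Schwarz: square summability alone makes the synthesis map on tails small, without any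
orthogonality of the `e n`. -/
lemma norm_sq_sum_le_of_sum_le {e : ℕ → H} {N : ℕ} {τ : ℝ}
    (hτ : ∀ s : Finset ℕ, (∀ n ∈ s, N ≤ n) → ∑ n ∈ s, ‖e n‖ ^ 2 ≤ τ) (a : ℕ →₀ ℂ)
    (ha : ∀ n < N, a n = 0) :
    ‖a.sum fun n t => t • e n‖ ^ 2 ≤ τ * a.sum fun _ t => ‖t‖ ^ 2 := by
  have hs : ∀ n ∈ a.support, N ≤ n := fun n hn => by
    by_contra hlt
    exact (Finsupp.mem_support_iff.mp hn) (ha n (not_le.mp hlt))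
  simp only [Finsupp.sum]
  calc ‖∑ n ∈ a.support, a n • e n‖ ^ 2 ≤ (∑ n ∈ a.support, ‖a n‖ * ‖e n‖) ^ 2 := by
        gcongr
        exact (norm_sum_le _ _).trans_eq (by simp only [norm_smul])
    _ ≤ (∑ n ∈ a.support, ‖a n‖ ^ 2) * ∑ n ∈ a.support, ‖e n‖ ^ 2 :=
        Finset.sum_mul_sq_le_sq_mul_sq _ _ _
    _ ≤ (∑ n ∈ a.support, ‖a n‖ ^ 2) * τ := by
        gcongr
        exact hτ _ hs
    _ = _ := mul_comm _ _

/-- Rescaling an asymptotically orthonormal sequence by positive factors tending to `1`. -/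
lemma IsAOSFrom.smul {N₀ : ℕ} {x : ℕ → H} (hx : IsAOSFrom N₀ x) {t τ : ℕ → ℝ}
    (hτ0 : ∀ N, 0 ≤ τ N) (hτ : Filter.Tendsto τ Filter.atTop (nhds 0))
    (hlo : ∀ N n, N ≤ n → 1 / (1 + τ N) ≤ t n ^ 2) (hhi : ∀ N n, N ≤ n → t n ^ 2 ≤ 1 + τ N) :
    IsAOSFrom N₀ fun n => (t n : ℂ) • x n := by
  obtain ⟨c, C, h, hc, hC⟩ := hx
  have h1 : Filter.Tendsto (fun N => 1 + τ N) Filter.atTop (nhds 1) := by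
    simpa using hτ.const_add 1
  refine ⟨fun N => c N * (1 / (1 + τ N)), fun N => C N * (1 + τ N), fun N hN => ?_, ?_, ?_⟩
  · obtain ⟨hc0, hC0, hN⟩ := h N hN
    have hp : 0 < 1 + τ N := by linarith [hτ0 N]
    refine ⟨by positivity, by positivity, fun a ha => ?_⟩
    have hs : ∀ n ∈ a.support, N ≤ n := fun n hn => by
      by_contra hlt
      exact (Finsupp.mem_support_iff.mp hn) (ha n (not_le.mp hlt))
    -- The scalars `t n` are absorbed into the coefficients.
    obtain ⟨l, u⟩ := hN (Finsupp.onFinset a.support (fun n => a n * (t n : ℂ))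
      fun n hn => Finsupp.mem_support_iff.mpr (left_ne_zero_of_mul hn))
      (fun n hn => by simp [ha n hn])
    rw [Finsupp.onFinset_sum _ (by simp), Finsupp.onFinset_sum _ (by simp)] at l u
    simp only [norm_mul, mul_pow, Complex.norm_real, Real.norm_eq_abs, sq_abs] at l u
    simp only [Finsupp.sum, smul_smul]
    constructor
    · refine le_trans ?_ l
      rw [mul_assoc, Finset.mul_sum]
      refine mul_le_mul_of_nonneg_left (Finset.sum_le_sum fun n hn => ?_) hc0.le
      rw [mul_comm]
      exact mul_le_mul_of_nonneg_left (hlo N n (hs n hn)) (by positivity)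
    · refine u.trans ?_
      rw [mul_assoc, Finset.mul_sum _ _ (1 + τ N)]
      refine mul_le_mul_of_nonneg_left (Finset.sum_le_sum fun n hn => ?_) hC0.le
      rw [mul_comm (1 + τ N)]
      exact mul_le_mul_of_nonneg_left (hhi N n (hs n hn)) (by positivity)
  · simpa using hc.mul (h1.inv₀ one_ne_zero)
  · simpa using hC.mul h1

lemma IsAOSFrom.comp_add {p : ℕ} {x : ℕ → H} (hx : IsAOSFrom p x) :
    IsAOB fun n => x (n + p) := by
  obtain ⟨c, C, h, hc, hC⟩ := hx
  refine ⟨fun N => c (N + p), fun N => C (N + p), fun N _ => ?_,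
    hc.comp (Filter.tendsto_add_atTop_nat p), hC.comp (Filter.tendsto_add_atTop_nat p)⟩
  obtain ⟨hc0, hC0, hN⟩ := h (N + p) (by omega)
  refine ⟨hc0, hC0, fun a ha => ?_⟩
  have := hN (a.mapDomain (· + p)) (fun n hn => ?_)
  · rwa [Finsupp.sum_mapDomain_index_inj (add_left_injective p),
      Finsupp.sum_mapDomain_index_inj (add_left_injective p)] at this
  · by_cases hnp : p ≤ n
    · obtain ⟨m, rfl⟩ := Nat.exists_eq_add_of_le' hnp
      rw [Finsupp.mapDomain_apply (add_left_injective p)]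
      exact ha m (by omega)
    · refine Finsupp.mapDomain_of_notMem_range _ _ ?_
      rintro ⟨m, hm⟩
      simp only at hm
      omega

/-- The asymptotic constants `c N` may fail to be positive for small `N`; one fixed positive bound
valid from `p` on repairs this. -/
lemma isAOSFrom_of_lower_bound {x : ℕ → H} {c C : ℕ → ℝ} {p : ℕ} {c₀ : ℝ} (hc₀ : 0 < c₀)
    (h₀ : ∀ a : ℕ →₀ ℂ, (∀ n < p, a n = 0) →
      c₀ * (a.sum fun _ t => ‖t‖ ^ 2) ≤ ‖a.sum fun n t => t • x n‖ ^ 2)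
    (hlo : ∀ N, ∀ a : ℕ →₀ ℂ, (∀ n < N, a n = 0) →
      c N * (a.sum fun _ t => ‖t‖ ^ 2) ≤ ‖a.sum fun n t => t • x n‖ ^ 2)
    (hC0 : ∀ N, 0 < C N)
    (hhi : ∀ N, ∀ a : ℕ →₀ ℂ, (∀ n < N, a n = 0) →
      ‖a.sum fun n t => t • x n‖ ^ 2 ≤ C N * (a.sum fun _ t => ‖t‖ ^ 2))
    (hc : Filter.Tendsto c Filter.atTop (nhds 1)) (hC : Filter.Tendsto C Filter.atTop (nhds 1)) :
    IsAOSFrom p x := by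
  -- Capping `c₀` at `1` keeps the limit of the maximum equal to `1`.
  refine ⟨fun N => max (c N) (min c₀ 1), C, fun N hN => ⟨?_, hC0 N, fun a ha => ⟨?_, hhi N a ha⟩⟩,
    ?_, hC⟩
  · exact lt_max_of_lt_right (lt_min hc₀ one_pos)
  · have hS : 0 ≤ a.sum fun _ t => ‖t‖ ^ 2 := Finset.sum_nonneg fun _ _ => by positivity
    rw [max_mul_of_nonneg _ _ hS]
    refine max_le (hlo N a ha) (le_trans ?_ (h₀ a fun n hn => ha n (by omega)))
    gcongr
    exact min_le_left _ _
  · have := hc.max (tendsto_const_nhds (x := min c₀ 1))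
    rwa [max_eq_left (min_le_right c₀ 1)] at this

/-- A positive lower Riesz bound for `(x n)_{n > p}` passes to `(x n)_{n ≥ p}` when some vector is
orthogonal to the former but not to `x p`. -/
lemma exists_lower_bound_of_inner_ne_zero {x : ℕ → H} {p : ℕ} {c : ℝ} (hc : 0 < c)
    (h : ∀ a : ℕ →₀ ℂ, (∀ n < p + 1, a n = 0) →
      c * (a.sum fun _ t => ‖t‖ ^ 2) ≤ ‖a.sum fun n t => t • x n‖ ^ 2)
    {f : H} (hf : ∀ n, p + 1 ≤ n → inner ℂ f (x n) = 0) (hfp : inner ℂ f (x p) ≠ 0) :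
    ∃ c' : ℝ, 0 < c' ∧ ∀ a : ℕ →₀ ℂ, (∀ n < p, a n = 0) →
      c' * (a.sum fun _ t => ‖t‖ ^ 2) ≤ ‖a.sum fun n t => t • x n‖ ^ 2 := by
  -- Pairing `v = ∑ a_n x_n` with `f` isolates `a_p` and gives `‖a p‖ ≤ D ‖v‖`. Then `v - a_p x_p`
  -- has norm at most `(1 + D ‖x p‖) ‖v‖`, so `h` controls the remaining coefficients; `B` adds the
  -- two bounds.
  set D := ‖f‖ / ‖inner ℂ f (x p)‖ with hD
  have hD0 : 0 ≤ D := by positivity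
  set B := D ^ 2 + (1 + D * ‖x p‖) ^ 2 / c with hB
  have hB0 : 0 < B := by
    have : 0 < (1 + D * ‖x p‖) ^ 2 / c := by positivity
    positivity
  refine ⟨B⁻¹, by positivity, fun a ha => ?_⟩
  have e1 : (a.sum fun n t => t • x n) = a p • x p + (a.erase p).sum fun n t => t • x n :=
    (Finsupp.add_sum_erase' a p _ (by simp)).symm
  have e2 : (a.sum fun _ t => ‖t‖ ^ 2) = ‖a p‖ ^ 2 + (a.erase p).sum fun _ t => ‖t‖ ^ 2 :=
    (Finsupp.add_sum_erase' a p (fun _ t => ‖t‖ ^ 2) (by simp)).symm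
  have ha' : ∀ n < p + 1, a.erase p n = 0 := fun n hn => by
    rcases eq_or_ne n p with rfl | hne
    · simp
    · rw [Finsupp.erase_ne hne]
      exact ha n (by omega)
  have h1 := h _ ha'
  set v := a.sum fun n t => t • x n with hv
  set y := (a.erase p).sum fun n t => t • x n with hy
  have hfy : inner ℂ f y = 0 := by
    rw [hy, Finsupp.sum, inner_sum]
    refine Finset.sum_eq_zero fun n hn => ?_
    rw [inner_smul_right, hf n, mul_zero]
    by_contra hlt
    exact (Finsupp.mem_support_iff.mp hn) (ha' n (by omega))
  have h2 : ‖a p‖ ≤ D * ‖v‖ := by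
    have : inner ℂ f v = a p * inner ℂ f (x p) := by
      rw [e1, inner_add_right, hfy, inner_smul_right, add_zero]
    have h3 := norm_inner_le_norm (𝕜 := ℂ) f v
    rw [this, norm_mul] at h3
    rw [hD, div_mul_eq_mul_div, le_div_iff₀ (norm_pos_iff.mpr hfp)]
    exact h3
  have h3 : ‖y‖ ≤ (1 + D * ‖x p‖) * ‖v‖ := by
    have : y = v - a p • x p := by rw [e1]; abel
    calc ‖y‖ ≤ ‖v‖ + ‖a p‖ * ‖x p‖ := by
          rw [this, ← norm_smul]
          exact norm_sub_le _ _
      _ ≤ ‖v‖ + D * ‖v‖ * ‖x p‖ := by gcongr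
      _ = _ := by ring
  rw [e2, inv_mul_le_iff₀ hB0]
  have h4 : (a.erase p).sum (fun _ t => ‖t‖ ^ 2) ≤ ((1 + D * ‖x p‖) * ‖v‖) ^ 2 / c := by
    rw [le_div_iff₀' hc]
    exact h1.trans (by gcongr)
  calc ‖a p‖ ^ 2 + (a.erase p).sum (fun _ t => ‖t‖ ^ 2)
      ≤ (D * ‖v‖) ^ 2 + ((1 + D * ‖x p‖) * ‖v‖) ^ 2 / c := by gcongr
    _ = B * ‖v‖ ^ 2 := by rw [hB]; ring

lemma dense_span_range_iff [CompleteSpace H] {ι : Type*} {x : ι → H} :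
    Dense (Submodule.span ℂ (Set.range x) : Set H) ↔
      ∀ f : H, (∀ n, inner ℂ (x n) f = 0) → f = 0 := by
  rw [Submodule.dense_iff_topologicalClosure_eq_top, Submodule.topologicalClosure_eq_top_iff,
    Submodule.eq_bot_iff]
  refine forall_congr' fun f => imp_congr_left ?_
  rw [Submodule.mem_orthogonal]
  refine ⟨fun h n => h _ (Submodule.subset_span ⟨n, rfl⟩), fun h u hu => ?_⟩
  induction hu using Submodule.span_induction with
  | mem u hu => obtain ⟨n, rfl⟩ := hu; exact h n
  | zero => simp
  | add u v _ _ hu hv => rw [inner_add_left, hu, hv, add_zero]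
  | smul t u _ hu => rw [inner_smul_left, hu, mul_zero]

lemma isCompleteSeq_iff [CompleteSpace H] {x : ℕ → H} :
    IsCompleteSeq x ↔ ∀ f : H, (∀ n, inner ℂ (x n) f = 0) → f = 0 := by
  rw [IsCompleteSeq, ← Submodule.dense_iff_topologicalClosure_eq_top, dense_span_range_iff]

lemma sum_le_tsum_nat_add {u : ℕ → ℝ} (hu : Summable u) (h0 : ∀ n, 0 ≤ u n) {N : ℕ}
    {s : Finset ℕ} (hs : ∀ n ∈ s, N ≤ n) : ∑ n ∈ s, u n ≤ ∑' n, u (n + N) := by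
  have e : ∑ n ∈ s, u n = ∑ m ∈ s.image (· - N), u (m + N) := by
    rw [Finset.sum_image]
    · exact Finset.sum_congr rfl fun n hn => by rw [Nat.sub_add_cancel (hs n hn)]
    · intro m hm n hn hmn
      have h1 := hs m hm
      have h2 := hs n hn
      simp only at hmn
      omega
  rw [e]
  exact ((summable_nat_add_iff N).mpr hu).sum_le_tsum _ fun n _ => h0 _

/-- Adding an orthogonal square summable perturbation preserves asymptotic orthonormality. -/
lemma IsAOSFrom.of_inner_eq_add {N₀ : ℕ} {x : ℕ → H} {y : ℕ → H'} {e : ℕ → H''}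
    (hy : IsAOSFrom N₀ y)
    (h : ∀ i j, inner ℂ (x i) (x j) = inner ℂ (y i) (y j) + inner ℂ (e i) (e j))
    (he : Summable fun n => ‖e n‖ ^ 2) : IsAOSFrom N₀ x := by
  obtain ⟨c, C, hN, hc, hC⟩ := hy
  refine ⟨c, fun N => C N + ∑' n, ‖e (n + N)‖ ^ 2, fun N hN0 => ?_, hc, ?_⟩
  · obtain ⟨hc0, hC0, hb⟩ := hN N hN0
    refine ⟨hc0, add_pos_of_pos_of_nonneg hC0 (tsum_nonneg fun _ => by positivity),
      fun a ha => ?_⟩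
    obtain ⟨l, u⟩ := hb a ha
    have h1 := norm_sq_sum_of_inner_eq_add h a
    have h2 := norm_sq_sum_le_of_sum_le (e := e) (N := N)
      (fun s hs => sum_le_tsum_nat_add he (fun _ => by positivity) hs) a ha
    rw [h1, add_mul]
    exact ⟨l.trans (le_add_of_nonneg_right (by positivity)), add_le_add u h2⟩
  · simpa using hC.add (tendsto_sum_nat_add fun n => ‖e n‖ ^ 2)

/-- Removing an orthogonal square summable perturbation from an asymptotically orthonormal basic
sequence leaves a sequence `y` with an asymptotically orthonormal tail. The longest such tail is
the whole sequence, or the term preceding it lies in the closed span of the tail. -/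
lemma IsAOB.exists_isAOSFrom {x : ℕ → H} {y : ℕ → H'} {e : ℕ → H''} (hx : IsAOB x)
    (h : ∀ i j, inner ℂ (x i) (x j) = inner ℂ (y i) (y j) + inner ℂ (e i) (e j))
    (he : Summable fun n => ‖e n‖ ^ 2) :
    ∃ p, IsAOSFrom p y ∧ ∀ q, p = q + 1 → ∀ f : H',
      (∀ n, q + 1 ≤ n → inner ℂ f (y n) = 0) → inner ℂ f (y q) = 0 := by
  obtain ⟨c, C, hN, hc, hC⟩ := hx
  have hc' : Filter.Tendsto (fun N => c N - ∑' n, ‖e (n + N)‖ ^ 2) Filter.atTop (nhds 1) := by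
    simpa using hc.sub (tendsto_sum_nat_add fun n => ‖e n‖ ^ 2)
  have hlo (N : ℕ) (a : ℕ →₀ ℂ) (ha : ∀ n < N, a n = 0) :
      (c N - ∑' n, ‖e (n + N)‖ ^ 2) * (a.sum fun _ t => ‖t‖ ^ 2)
        ≤ ‖a.sum fun n t => t • y n‖ ^ 2 := by
    have h1 := norm_sq_sum_of_inner_eq_add h a
    have h2 := norm_sq_sum_le_of_sum_le (e := e) (N := N)
      (fun s hs => sum_le_tsum_nat_add he (fun _ => by positivity) hs) a ha
    have h3 := ((hN N N.zero_le).2.2 a ha).1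
    rw [sub_mul]
    linarith
  have hhi (N : ℕ) (a : ℕ →₀ ℂ) (ha : ∀ n < N, a n = 0) :
      ‖a.sum fun n t => t • y n‖ ^ 2 ≤ C N * (a.sum fun _ t => ‖t‖ ^ 2) := by
    refine le_trans ?_ ((hN N N.zero_le).2.2 a ha).2
    have := norm_sum_le_of_inner_eq_add h a
    gcongr
  have hex : ∃ p, ∃ c₀ : ℝ, 0 < c₀ ∧ ∀ a : ℕ →₀ ℂ, (∀ n < p, a n = 0) →
      c₀ * (a.sum fun _ t => ‖t‖ ^ 2) ≤ ‖a.sum fun n t => t • y n‖ ^ 2 := by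
    obtain ⟨p, hp⟩ := (hc'.eventually (lt_mem_nhds (zero_lt_one' ℝ))).exists
    exact ⟨p, _, hp, hlo p⟩
  classical
  -- The least admissible `p` is taken, not merely some `p`: a functional killing the tail but not
  -- `y q` would extend the lower bound to `q = p - 1`.
  obtain ⟨c₀, hc₀, hb⟩ := Nat.find_spec hex
  refine ⟨Nat.find hex, isAOSFrom_of_lower_bound hc₀ hb hlo (fun N => (hN N N.zero_le).2.1) hhi
    hc' hC, fun q hq f hf => ?_⟩
  by_contra hfq
  rw [hq] at hb
  exact Nat.find_min hex (m := q) (by omega) (exists_lower_bound_of_inner_ne_zero hc₀ hb hf hfq)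

lemma IsAOB.injective {x : ℕ → H} (hx : IsAOB x) : Function.Injective x := by
  intro m n hmn
  by_contra hne
  obtain ⟨c, C, hN, -, -⟩ := hx
  obtain ⟨hc0, -, hb⟩ := hN 0 le_rfl
  have h1 := (hb (Finsupp.single m 1 - Finsupp.single n 1) (by simp)).1
  have h2 : (Finsupp.single m (1 : ℂ) - Finsupp.single n 1).sum (fun k t => t • x k) = 0 := by
    rw [Finsupp.sum_sub_index fun k s t => sub_smul s t (x k)]
    simp [hmn]
  have h3 : 0 < (Finsupp.single m (1 : ℂ) - Finsupp.single n 1).sum fun _ t => ‖t‖ ^ 2 := by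
    refine Finset.sum_pos (fun k hk => ?_) ⟨m, ?_⟩
    · have := norm_pos_iff.mpr (Finsupp.mem_support_iff.mp hk)
      positivity
    · simp [Ne.symm hne]
  rw [h2] at h1
  have := mul_pos hc0 h3
  simp at h1
  linarith

end Hilbert

/-! ### Kernels, continuity and inclusion of the spaces `𝓗(b)` -/

lemma inner_repKernel_repKernel (b : HInfBall) (l z : ℍ) :
    inner ℂ (repKernel b z) (repKernel b l) = kernelValue b l z := by
  rw [inner_repKernel, repKernel_apply]

lemma inner_normKernel_eq_zero_iff {b : HInfBall} {l : ℍ} (hl : repKernel b l ≠ 0) {f : DBR b} :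
    inner ℂ (normKernel b l) f = 0 ↔ f l = 0 := by
  rw [normKernel, inner_smul_left, inner_repKernel]
  simp [hl]

/-- `‖k_z - k_w‖²` is a combination of four kernel values, and the kernel is jointly continuous. -/
lemma continuous_repKernel (b : HInfBall) : Continuous (repKernel b) := by
  have hb : Continuous (b : ℍ → ℂ) := b.holo.continuous
  have hK : Continuous fun q : ℍ × ℍ => kernelValue b q.1 q.2 := by
    unfold kernelValue
    refine continuous_const.mul (Continuous.div ?_ ?_ fun q => sub_conj_ne_zero _ _)
    · exact continuous_const.sub ((Complex.continuous_conj.comp (hb.comp continuous_fst)).mul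
        (hb.comp continuous_snd))
    · exact (UpperHalfPlane.continuous_coe.comp continuous_snd).sub
        (Complex.continuous_conj.comp (UpperHalfPlane.continuous_coe.comp continuous_fst))
  rw [continuous_iff_continuousAt]
  intro w
  rw [ContinuousAt, tendsto_iff_norm_sub_tendsto_zero]
  have e (z : ℍ) : ‖repKernel b z - repKernel b w‖
      = √(kernelValue b z z - kernelValue b w z - kernelValue b z w + kernelValue b w w).re := by
    rw [@norm_eq_sqrt_re_inner ℂ]
    simp only [inner_sub_left, inner_sub_right, inner_repKernel_repKernel]
    congr 1
    simp only [map_sub, Complex.sub_re, Complex.add_re, RCLike.re_eq_complex_re]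
    ring
  simp only [e]
  have hcont : Continuous fun z : ℍ =>
      √(kernelValue b z z - kernelValue b w z - kernelValue b z w + kernelValue b w w).re := by
    refine Real.continuous_sqrt.comp (Complex.continuous_re.comp ?_)
    exact (((hK.comp (continuous_id.prodMk continuous_id)).sub
      (hK.comp (continuous_const.prodMk continuous_id))).sub
      (hK.comp (continuous_id.prodMk continuous_const))).add continuous_const
  simpa using hcont.tendsto w

lemma continuous_coe_DBR {b : HInfBall} (f : DBR b) : Continuous f := by
  have : (f : ℍ → ℂ) = fun z => inner ℂ (repKernel b z) f := by
    ext z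
    rw [inner_repKernel]
  rw [this]
  exact (continuous_repKernel b).inner continuous_const

/-- Continuity suffices, because the complement of a finite set is dense in `ℍ`. -/
lemma eq_zero_of_forall_notMem {b : HInfBall} (f : DBR b) {s : Set ℍ}
    (hs : s.Finite) (h : ∀ z ∉ s, f z = 0) : f = 0 := by
  have hd : Dense ((Set.univ : Set ℍ) \ s) := dense_univ.sdiff_finite hs
  have := (continuous_coe_DBR f).ext_on hd continuous_const
    (fun z hz => h z (by simpa using hz) : Set.EqOn f (fun _ => (0 : ℂ)) _)
  ext z
  simpa using congrFun this z

lemma kernelValue_of_mul {b₁ b₂ b : HInfBall} (hdiv : ∀ z, b₁ z = b₂ z * b z) (l z : ℍ) :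
    kernelValue b₁ l z
      = kernelValue b₂ l z + conj (b₂ l) * b₂ z * kernelValue b l z := by
  have := sub_conj_ne_zero z l
  simp only [kernelValue, hdiv, map_mul]
  field_simp
  ring

lemma dense_span_repKernel (b : HInfBall) :
    Dense (Submodule.span ℂ (Set.range (repKernel b)) : Set (DBR b)) := by
  refine dense_span_range_iff.mpr fun f hf => ?_
  ext z
  simpa [inner_repKernel] using hf z

/-- The space `𝓗(b₂)` is contained in `𝓗(b₂ b)`. -/
lemma exists_inclusion {b₁ b₂ b : HInfBall} (hdiv : ∀ z, b₁ z = b₂ z * b z) :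
    ∃ J : DBR b₂ →L[ℂ] DBR b₁, ∀ f z, J f z = f z := by
  obtain ⟨E, hE⟩ := exists_clm_of_norm_sum_le (x := repKernel b₁) (y := repKernel b₂)
    (dense_span_repKernel b₁) (norm_sum_le_of_inner_eq_add
      (e := fun l => conj (b₂ l) • repKernel b l) fun z l => by
        simp only [inner_smul_left, inner_smul_right, inner_repKernel_repKernel,
          Complex.conj_conj, kernelValue_of_mul hdiv]
        ring)
  -- `E` sends `k_z^{b₁}` to `k_z^{b₂}`, so its adjoint preserves point values.
  refine ⟨E.adjoint, fun f z => ?_⟩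
  rw [← inner_repKernel, ContinuousLinearMap.adjoint_inner_right, hE, inner_repKernel]

/-! ### Division by Blaschke factors and uniqueness on tails -/

/-- The Blaschke factor of the upper half-plane with zero `m`. -/
noncomputable def blaschke (m z : ℍ) : ℂ := ((z : ℂ) - m) / (z - conj (m : ℂ))

lemma blaschke_ne_zero {m z : ℍ} (h : z ≠ m) : blaschke m z ≠ 0 :=
  div_ne_zero (sub_ne_zero.mpr fun h' => h (UpperHalfPlane.ext h')) (sub_conj_ne_zero z m)

lemma blaschke_injective (m : ℍ) : Function.Injective (blaschke m) := by
  intro z w h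
  have h1 := sub_conj_ne_zero z m
  have h2 := sub_conj_ne_zero w m
  have h3 := sub_conj_ne_zero m m
  rw [blaschke, blaschke, div_eq_div_iff h1 h2] at h
  have h4 : ((m : ℂ) - conj (m : ℂ)) * (z - w) = 0 := by linear_combination h
  exact UpperHalfPlane.ext (sub_eq_zero.mp ((mul_eq_zero.mp h4).resolve_left h3))

/-- With `Z = z`, `W = conj w`, `M = m`, `B = b z`, `B' = conj (b w)`, `C = b m` and `M'`, `C'` the
conjugates of `M`, `C`, the left side is `β(z) conj (β(w)) k_w(z)` for the Blaschke factor `β` of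
`m`. On the right stand the kernel of the functions vanishing at `m` and a positive rank-one term.
Conjugates are treated as independent variables, so the identity is purely algebraic. -/
lemma kernel_blaschke_identity {K : Type*} [Field K] {k Z W M M' B B' C C' : K} (hk : k ≠ 0)
    (hZW : Z - W ≠ 0) (hZM : Z - M' ≠ 0) (hMW : M - W ≠ 0) (hMM : M - M' ≠ 0)
    (hC : 1 - C' * C ≠ 0) :
    (Z - M) / (Z - M') * ((W - M') / (W - M)) * (k * ((1 - B' * B) / (Z - W)))
      = k * ((1 - B' * B) / (Z - W))
        - k * ((1 - C' * B) / (Z - M')) * (k * ((1 - B' * C) / (M - W)))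
          / (k * ((1 - C' * C) / (M - M')))
        + (M - M') * (B - C) / ((1 - C' * C) * (Z - M'))
          * ((M' - M) * (B' - C') / ((1 - C' * C) * (W - M)))
          * (k * ((1 - C' * C) / (M - M'))) := by
  have hWM : W - M ≠ 0 := by rw [← neg_sub]; exact neg_ne_zero.mpr hMW
  rw [← neg_sub M W] at *
  field_simp
  ring

lemma kernelValue_self_ne_zero {b : HInfBall} {m : ℍ} (hm : repKernel b m ≠ 0) :
    kernelValue b m m ≠ 0 := by
  rw [← inner_repKernel_repKernel]
  exact inner_self_ne_zero.mpr hm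

/-- Division by a Blaschke factor: a bounded operator on `𝓗(b)` that divides by `blaschke m` the
functions vanishing at `m`. -/
lemma exists_blaschke_quotient {b : HInfBall} {m : ℍ} (hm : repKernel b m ≠ 0) :
    ∃ D : DBR b →L[ℂ] DBR b, ∀ f : DBR b, f m = 0 → ∀ z, z ≠ m → blaschke m z * D f z = f z := by
  have hmm := kernelValue_self_ne_zero hm
  let x : {z : ℍ // z ≠ m} → DBR b := fun z => repKernel b z
  -- The component of `k_z` orthogonal to `k_m`, divided by `conj (β(z))`: pairing it with an `f`
  -- vanishing at `m` gives `f z / β(z)`. The family `e` carries the rank-one remainder. The point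
  -- `m` is excluded because `β(m) = 0`.
  let y : {z : ℍ // z ≠ m} → DBR b := fun z => (conj (blaschke m z))⁻¹ •
    (repKernel b z - (kernelValue b z m / kernelValue b m m) • repKernel b m)
  let e : {z : ℍ // z ≠ m} → DBR b := fun z => ((conj (blaschke m z))⁻¹ *
    conj (((m : ℂ) - conj (m : ℂ)) * (b z - b m) /
      ((1 - conj (b m) * b m) * ((z : ℂ) - conj (m : ℂ))))) • repKernel b m
  have hx : Dense (Submodule.span ℂ (Set.range x) : Set (DBR b)) := by
    refine dense_span_range_iff.mpr fun f hf => eq_zero_of_forall_notMem f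
      (Set.finite_singleton m) fun z hz => ?_
    rw [← inner_repKernel]
    exact hf ⟨z, by simpa using hz⟩
  have gram (z w : {z : ℍ // z ≠ m}) :
      inner ℂ (x z) (x w) = inner ℂ (y z) (y w) + inner ℂ (e z) (e w) := by
    have hz := blaschke_ne_zero z.2
    have hw : conj (blaschke m w) ≠ 0 := (map_ne_zero _).mpr (blaschke_ne_zero w.2)
    have hC : 1 - conj (b m) * b m ≠ 0 := by
      intro h
      apply hmm
      simp [kernelValue, h]
    have hk : Complex.I / (2 * Real.pi) ≠ 0 := by simp [Real.pi_ne_zero]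
    have id := kernel_blaschke_identity (k := Complex.I / (2 * Real.pi)) (B := b z)
      (B' := conj (b w)) hk (sub_conj_ne_zero z w) (sub_conj_ne_zero z m) (sub_conj_ne_zero m w)
      (sub_conj_ne_zero m m) hC
    have hwb : conj (blaschke m w) =
        (conj ((w : ℍ) : ℂ) - conj (m : ℂ)) / (conj ((w : ℍ) : ℂ) - m) := by
      simp [blaschke]
    have hg : conj (((m : ℂ) - conj (m : ℂ)) * (b w - b m) /
        ((1 - conj (b m) * b m) * (((w : ℍ) : ℂ) - conj (m : ℂ))))
        = (conj (m : ℂ) - m) * (conj (b w) - conj (b m))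
          / ((1 - conj (b m) * b m) * (conj ((w : ℍ) : ℂ) - m)) := by
      simp [mul_comm (b m)]
    have hx : inner ℂ (x z) (x w) = kernelValue b w z := inner_repKernel_repKernel _ _ _
    have hy : inner ℂ (y z) (y w) = (blaschke m z)⁻¹ * (conj (blaschke m w))⁻¹ *
        (kernelValue b w z - kernelValue b m z * kernelValue b w m / kernelValue b m m) := by
      simp only [y, inner_smul_left, inner_smul_right, inner_sub_left, inner_sub_right,
        inner_repKernel_repKernel, map_inv₀, map_div₀, Complex.conj_conj, conj_kernelValue]
      field_simp
      ring
    have he : inner ℂ (e z) (e w) = (blaschke m z)⁻¹ * (conj (blaschke m w))⁻¹ *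
        (((m : ℂ) - conj (m : ℂ)) * (b z - b m) /
          ((1 - conj (b m) * b m) * (((z : ℍ) : ℂ) - conj (m : ℂ))) *
        ((conj (m : ℂ) - m) * (conj (b w) - conj (b m))
          / ((1 - conj (b m) * b m) * (conj ((w : ℍ) : ℂ) - m))) * kernelValue b m m) := by
      simp only [e, inner_smul_left, inner_smul_right, inner_repKernel_repKernel, hg]
      rw [map_mul, map_inv₀, Complex.conj_conj, Complex.conj_conj]
      ring
    rw [hx, hy, he, ← mul_add]
    change _ = _ * (_ - _ + _)
    rw [eq_comm, ← mul_inv, inv_mul_eq_iff_eq_mul₀ (mul_ne_zero hz hw), hwb]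
    exact id.symm
  obtain ⟨E, hE⟩ := exists_clm_of_norm_sum_le hx (norm_sum_le_of_inner_eq_add gram)
  refine ⟨E.adjoint, fun f hf z hz => ?_⟩
  have h1 : E (repKernel b z) = y ⟨z, hz⟩ := hE ⟨z, hz⟩
  rw [← inner_repKernel b z, ContinuousLinearMap.adjoint_inner_right, h1]
  simp only [y, inner_smul_left, inner_sub_left, inner_repKernel, hf, mul_zero, sub_zero,
    map_inv₀, Complex.conj_conj]
  exact mul_inv_cancel_left₀ (blaschke_ne_zero hz) _

/-- If every function of `𝓗(b)` vanishing at `λ_n`, `n > p`, also vanishes at `λ_p`, and the whole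
sequence is a uniqueness sequence, then so is the tail `(λ_n)_{n > p}`. -/
lemma eq_zero_of_forall_apply_eq_zero {b : HInfBall} {lam : ℕ → ℍ} {p : ℕ}
    (hp : repKernel b (lam p) ≠ 0) (hne : ∀ n, p + 1 ≤ n → lam n ≠ lam p)
    (huniq : ∀ f : DBR b, (∀ n, f (lam n) = 0) → f = 0)
    (hvan : ∀ f : DBR b, (∀ n, p + 1 ≤ n → f (lam n) = 0) → f (lam p) = 0) (f : DBR b)
    (hf : ∀ n, p + 1 ≤ n → f (lam n) = 0) : f = 0 := by
  let V : Submodule ℂ (DBR b) :=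
    { carrier := {g | ∀ n, p + 1 ≤ n → g (lam n) = 0}
      add_mem' := fun {g h} hg hh n hn => by simp [hg n hn, hh n hn]
      zero_mem' := fun n _ => by simp
      smul_mem' := fun t g hg n hn => by simp [hg n hn] }
  let ev : V →ₗ[ℂ] (Fin (p + 1) → ℂ) :=
    { toFun := fun g i => (g : DBR b) (lam i)
      map_add' := fun g h => by ext; simp
      map_smul' := fun t g => by ext; simp }
  have hev : Function.Injective ev := by
    rw [injective_iff_map_eq_zero]
    intro g hg
    refine Subtype.ext (huniq _ fun n => ?_)
    by_cases hn : p + 1 ≤ n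
    · exact g.2 n hn
    · exact congrFun hg ⟨n, by omega⟩
  have hfin : FiniteDimensional ℂ V := Module.Finite.of_injective ev hev
  obtain ⟨D, hD⟩ := exists_blaschke_quotient hp
  -- On `V` the quotient still vanishes at the tail points, as these differ from `lam p`; `hvan` is
  -- what allows the division.
  have hDV : ∀ g ∈ V, (D : DBR b →ₗ[ℂ] DBR b) g ∈ V := by
    intro g hg n hn
    have h1 := hD g (hvan g hg) (lam n) (hne n hn)
    rw [hg n hn] at h1
    exact (mul_eq_zero.mp h1).resolve_left (blaschke_ne_zero (hne n hn))
  by_contra hf0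
  have : Nontrivial V := ⟨⟨⟨f, hf⟩, 0, fun h => hf0 (congrArg Subtype.val h)⟩⟩
  obtain ⟨c, hc⟩ := Module.End.exists_eigenvalue ((D : DBR b →ₗ[ℂ] DBR b).restrict hDV)
  obtain ⟨g, hg⟩ := hc.exists_hasEigenvector
  have hDg : D (g : DBR b) = c • (g : DBR b) := congrArg Subtype.val hg.apply_eq_smul
  -- From `D g = c g` and `β · D g = g`, the product `β(z) c` is `1` wherever `g z ≠ 0` off `lam p`;
  -- as `β` is injective, there is at most one such point.
  have hval : ∀ z, z ≠ lam p → (g : DBR b) z ≠ 0 → blaschke (lam p) z * c = 1 := by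
    intro z hz hgz
    have h1 := hD g (hvan g g.2) z hz
    rw [hDg, RKHS.coe_smul, Pi.smul_apply, smul_eq_mul, ← mul_assoc] at h1
    exact mul_right_cancel₀ hgz (h1.trans (one_mul _).symm)
  refine hg.2 (Subtype.ext ?_)
  by_cases hex : ∃ w, w ≠ lam p ∧ (g : DBR b) w ≠ 0
  · obtain ⟨w, hw, hgw⟩ := hex
    refine eq_zero_of_forall_notMem _ (Set.toFinite {lam p, w}) fun z hz => ?_
    simp only [Set.mem_insert_iff, not_or] at hz
    by_contra hgz
    have h1 := hval z hz.1 hgz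
    have h2 := hval w hw hgw
    have hc0 : c ≠ 0 := right_ne_zero_of_mul (h1.trans_ne one_ne_zero)
    exact hz.2 (blaschke_injective _ (mul_right_cancel₀ hc0 (h1.trans h2.symm)))
  · push Not at hex
    exact eq_zero_of_forall_notMem _ (Set.finite_singleton (lam p)) fun z hz =>
      hex z (by simpa using hz)

/-! ### Nondegeneracy of the kernels and the defect vectors -/

/-- If `k_l = 0` then `conj (b l) * b z = 1` for every `z`, and `|b| ≤ 1` forces `|b z| = 1`; no
maximum principle is needed. -/
lemma repKernel_eq_zero_of_repKernel_eq_zero {b : HInfBall} {l : ℍ} (h : repKernel b l = 0) (z : ℍ) :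
    repKernel b z = 0 := by
  have h1 : kernelValue b l z = 0 := by rw [← repKernel_apply, h]; simp
  have hne := sub_conj_ne_zero z l
  have h2 : conj (b l) * b z = 1 := by
    simp only [kernelValue, mul_eq_zero, div_eq_zero_iff, hne, or_false] at h1
    rcases h1 with h1 | h1
    · simp [Real.pi_ne_zero] at h1
    · exact (sub_eq_zero.mp h1).symm
  have h3 : ‖b l‖ * ‖b z‖ = 1 := by simpa using congrArg norm h2
  have h4 : ‖b z‖ = 1 := by
    nlinarith [b.bound l, b.bound z, norm_nonneg (b l), norm_nonneg (b z)]
  have h5 := norm_repKernel_sq b z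
  rw [h4] at h5
  simpa using h5

/-- This rules out a unimodular constant `b₂`: all its kernels vanish, division by zero makes every
ratio `0`, and the series becomes `∑ 1`. -/
lemma repKernel_ne_zero_of_summable {b₁ b₂ : HInfBall} {lam : ℕ → ℍ}
    (hsum : Summable fun n => |kernelRatio b₁ b₂ (lam n) - 1|) (l : ℍ) : repKernel b₂ l ≠ 0 := by
  intro h
  have h1 : (fun n => |kernelRatio b₁ b₂ (lam n) - 1|) = fun _ => 1 := by
    ext n
    simp [kernelRatio, repKernel_eq_zero_of_repKernel_eq_zero h (lam n)]
  rw [h1] at hsum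
  exact one_ne_zero ((summable_const_iff (1 : ℝ)).mp hsum)

section Comparison

variable {b₁ b₂ b : HInfBall}

/-- The component of `k_λ^{b₁} / ‖k_λ^{b₂}‖` orthogonal to `𝓗(b₂)`, as an element of `𝓗(b)`. -/
noncomputable def defectKernel (b₂ b : HInfBall) (l : ℍ) : DBR b :=
  (((‖repKernel b₂ l‖⁻¹ : ℝ) : ℂ) * conj (b₂ l)) • repKernel b l

lemma inner_smul_repKernel_eq_add (hdiv : ∀ z, b₁ z = b₂ z * b z) (l z : ℍ) :
    inner ℂ (((‖repKernel b₂ l‖⁻¹ : ℝ) : ℂ) • repKernel b₁ l)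
        (((‖repKernel b₂ z‖⁻¹ : ℝ) : ℂ) • repKernel b₁ z)
      = inner ℂ (normKernel b₂ l) (normKernel b₂ z)
        + inner ℂ (defectKernel b₂ b l) (defectKernel b₂ b z) := by
  simp only [normKernel, defectKernel, inner_smul_left, inner_smul_right,
    inner_repKernel_repKernel, kernelValue_of_mul hdiv, map_mul, Complex.conj_conj,
    Complex.conj_ofReal]
  ring

lemma norm_defectKernel_sq (hdiv : ∀ z, b₁ z = b₂ z * b z) {l : ℍ} (hl : repKernel b₂ l ≠ 0) :
    ‖defectKernel b₂ b l‖ ^ 2 = kernelRatio b₁ b₂ l - 1 := by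
  have h := inner_smul_repKernel_eq_add hdiv l l
  simp only [inner_self_eq_norm_sq_to_K] at h
  have h' : ‖((‖repKernel b₂ l‖⁻¹ : ℝ) : ℂ) • repKernel b₁ l‖ ^ 2
      = ‖normKernel b₂ l‖ ^ 2 + ‖defectKernel b₂ b l‖ ^ 2 := by exact_mod_cast h
  have hn := norm_ne_zero_iff.mpr hl
  rw [normKernel, norm_smul, norm_smul, Complex.norm_real, norm_inv, norm_norm,
    inv_mul_cancel₀ hn] at h'
  rw [kernelRatio]
  linear_combination -h' + (by field_simp :
    (‖repKernel b₂ l‖⁻¹ * ‖repKernel b₁ l‖) ^ 2 = ‖repKernel b₁ l‖ ^ 2 / ‖repKernel b₂ l‖ ^ 2)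

end Comparison

end HbSpace

/-! ### The comparison theorem -/

open HbSpace in
theorem theorem5p2 (b₁ b₂ b : HbSpace.HInfBall) (hdiv : ∀ z, b₁ z = b₂ z * b z)
    (lam : ℕ → UpperHalfPlane)
    (hsum : Summable fun n => |HbSpace.kernelRatio b₁ b₂ (lam n) - 1|) :
    (HbSpace.IsAOB (fun n => HbSpace.normKernel b₁ (lam n)) ∧
        HbSpace.IsCompleteSeq (fun n => HbSpace.normKernel b₁ (lam n)) →
      ∃ p : ℕ, HbSpace.IsAOB (fun n => HbSpace.normKernel b₂ (lam (n + p))) ∧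
        HbSpace.IsCompleteSeq (fun n => HbSpace.normKernel b₂ (lam (n + p)))) ∧
    (HbSpace.IsAOB (fun n => HbSpace.normKernel b₂ (lam n)) →
      HbSpace.IsAOB (fun n => HbSpace.normKernel b₁ (lam n))) := by
  have h2 := repKernel_ne_zero_of_summable hsum
  have hd (n : ℕ) := norm_defectKernel_sq hdiv (h2 (lam n))
  have he : Summable fun n => ‖defectKernel b₂ b (lam n)‖ ^ 2 := by
    refine hsum.congr fun n => ?_
    rw [← hd, abs_of_nonneg (by positivity)]
  -- A vanishing `k_l^{b₁}` would make the ratio `0`, whereas it equals `1 + ‖e‖²`.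
  have h1 (l : UpperHalfPlane) : repKernel b₁ l ≠ 0 := by
    intro h
    have := norm_defectKernel_sq hdiv (h2 l)
    rw [kernelRatio, h, norm_zero] at this
    norm_num at this
    nlinarith [sq_nonneg ‖defectKernel b₂ b l‖]
  have gram (i j : ℕ) := inner_smul_repKernel_eq_add hdiv (lam i) (lam j)
  set τ : ℕ → ℝ := fun N => ∑' n, ‖defectKernel b₂ b (lam (n + N))‖ ^ 2
  have hτ0 (N : ℕ) : 0 ≤ τ N := tsum_nonneg fun _ => by positivity
  have hτt : Filter.Tendsto τ Filter.atTop (nhds 0) :=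
    tendsto_sum_nat_add fun n => ‖defectKernel b₂ b (lam n)‖ ^ 2
  have hratio (n : ℕ) : 1 ≤ kernelRatio b₁ b₂ (lam n) := by
    nlinarith [sq_nonneg ‖defectKernel b₂ b (lam n)‖, hd n]
  have hratio' (N n : ℕ) (hn : N ≤ n) : kernelRatio b₁ b₂ (lam n) ≤ 1 + τ N := by
    have := sum_le_tsum_nat_add he (fun _ => by positivity) (N := N) (s := {n}) (by simpa using hn)
    rw [Finset.sum_singleton, hd] at this
    linarith
  constructor
  · rintro ⟨haob, hcomp⟩
    -- Normalizing `k^{b₁}` by the norm of `k^{b₂}` makes the Gram decomposition exact; the squared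
    -- rescaling factor is the kernel ratio, which lies in `[1, 1 + τ N]` for `n ≥ N`.
    have hx : IsAOB fun n => ((‖repKernel b₂ (lam n)‖⁻¹ : ℝ) : ℂ) • repKernel b₁ (lam n) := by
      have := IsAOSFrom.smul haob (t := fun n => ‖repKernel b₁ (lam n)‖ / ‖repKernel b₂ (lam n)‖)
        hτ0 hτt (fun N n _ => by
          rw [div_pow]
          refine le_trans ?_ (hratio n)
          exact div_le_one_of_le₀ (by linarith [hτ0 N]) (by linarith [hτ0 N]))
        (fun N n hn => by rw [div_pow]; exact hratio' N n hn)
      convert! this using 2 with n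
      rw [normKernel, smul_smul, ← Complex.ofReal_mul]
      have := norm_ne_zero_iff.mpr (h1 (lam n))
      congr 2
      field_simp
    obtain ⟨p, hp, hvan⟩ := IsAOB.exists_isAOSFrom hx gram he
    have huniq : ∀ f : DBR b₂, (∀ n, f (lam n) = 0) → f = 0 := by
      intro f hf
      obtain ⟨J, hJ⟩ := exists_inclusion hdiv
      have hJf : J f = 0 := isCompleteSeq_iff.mp hcomp _ fun n => by
        rw [inner_normKernel_eq_zero_iff (h1 _), hJ, hf]
      ext z
      rw [← hJ, hJf]
      simp
    refine ⟨p, hp.comp_add, isCompleteSeq_iff.mpr fun f hf => ?_⟩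
    have hf' : ∀ n, p ≤ n → f (lam n) = 0 := by
      intro n hn
      obtain ⟨m, rfl⟩ := Nat.exists_eq_add_of_le' hn
      exact (inner_normKernel_eq_zero_iff (h2 _)).mp (hf m)
    -- For `p = 0` nothing has been removed; otherwise minimality of `p` supplies the vanishing at
    -- `lam q`.
    rcases p with _ | q
    · exact huniq f fun n => hf' n n.zero_le
    · refine eq_zero_of_forall_apply_eq_zero (h2 (lam q)) (fun n hn h => ?_) huniq
        (fun g hg => ?_) f hf'
      · have := haob.injective (congrArg (normKernel b₁) h)
        omega
      · rw [← inner_normKernel_eq_zero_iff (h2 _), inner_eq_zero_symm]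
        refine hvan q rfl g fun n hn => ?_
        rw [inner_eq_zero_symm, inner_normKernel_eq_zero_iff (h2 _)]
        exact hg n hn
  · intro haob
    -- The same renormalization in reverse: the squared factor is now the inverse ratio, in `[1 / (1
    -- + τ N), 1]`.
    have hx := IsAOSFrom.of_inner_eq_add haob gram he
    have hinv (n : ℕ) : (‖repKernel b₂ (lam n)‖ / ‖repKernel b₁ (lam n)‖) ^ 2
        = 1 / kernelRatio b₁ b₂ (lam n) := by
      rw [kernelRatio, one_div_div, div_pow]
    have := IsAOSFrom.smul hx (t := fun n => ‖repKernel b₂ (lam n)‖ / ‖repKernel b₁ (lam n)‖)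
      hτ0 hτt (fun N n hn => by
        rw [hinv]
        exact one_div_le_one_div_of_le (by linarith [hratio n]) (hratio' N n hn))
      (fun N n _ => by
        rw [hinv]
        refine le_trans (div_le_one_of_le₀ (hratio n) (by linarith [hratio n])) ?_
        linarith [hτ0 N])
    convert! this using 2 with n
    rw [normKernel, smul_smul, ← Complex.ofReal_mul]
    have := norm_ne_zero_iff.mpr (h2 (lam n))
    congr 2
    field_simp
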